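/- Let $d\ge 2$ and let $\|\cdot\|_D$ be a $D$-norm on $\mathbb{R}^d$, i.e. $\|x\|_D=E\big(\max_{1\le i\le d}|x_i|Z_i\big)$ for some random vector $Z=(Z_1,\dots,Z_d)$ with $Z_i\ge 0$ almost surely and $E(Z_i)=1$ for all $i$. Let $U$ be a random vector in $\mathbb{R}^d$ following a generalized Pareto copula $C$ with $D$-norm $\|\cdot\|_D$: each component of $U$ is uniformly distributed on $[0,1]$, and there is $u_0\in(0,1)^d$ such that the distribution function $C$ of $U$ satisfies \[ C(u)=1-\|\mathbf 1-u\|_D,\qquad u\in[u_0,\mathbf 1]. \] Assume that $\|\cdot\|_D$ has partial derivatives of order $d$ in the following sense: for all pairwise distinct $i_1,\dots,i_k\in\{1,\dots,d\}$ (in any order, $1\le k\le d$) the iterated partial derivative $\partial^k\|x\|_D/\partial x_{i_1}\cdots\partial x_{i_k}$ exists at every point $x\in(-\infty,0)^d$ (continuity is not required). Let $U^{(1)},U^{(2)},\dots$ be independent copies of $U$ and let $M^{(n)}=\big(\max_{1\le i\le n}U^{(i)}_1,\dots,\max_{1\le i\le n}U^{(i)}_d\big)$. Then there is a probability measure $G$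 on $\mathbb{R}^d$ with distribution function $G(x)=\exp(-\|x\|_D)$ for $x\in(-\infty,0]^d$ (the standard max-stable distribution with $D$-norm $\|\cdot\|_D$), and, for every such $G$, \[ \sup_{A\in\mathbb B^d}\Big|P\big(n(M^{(n)}-\mathbf 1)\in A\big)-G(A)\Big|\longrightarrow 0\qquad(n\to\infty), \] where $\mathbb B^d$ is the Borel $\sigma$-field of $\mathbb{R}^d$. -/

import Mathlib

open MeasureTheory ProbabilityTheory Filter Topology

noncomputable section

/-- `N` is a D-norm on `ℝ^d`: `N x = E (max_i |x_i| Z_i)` for a random vector `Z` (the generator,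
given here by its law `ν` on `ℝ^d`) with `Z_i ≥ 0` almost surely and `E Z_i = 1` for every `i`.
(The condition `E Z_i = 1` entails that `Z_i` is integrable.) -/
def IsDNorm {d : ℕ} (N : (Fin d → ℝ) → ℝ) : Prop :=
  ∃ ν : Measure (Fin d → ℝ), IsProbabilityMeasure ν ∧
    (∀ i, ∀ᵐ z ∂ν, 0 ≤ z i) ∧
    (∀ i, ∫ z, z i ∂ν = 1) ∧
    ∀ x, N x = ∫ z, ⨆ i, |x i| * z i ∂ν

/-- A copula on `ℝ^d`, as a Borel probability measure: every one-dimensional margin is the uniform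
distribution on `[0, 1]`. Its distribution function is `u ↦ C.real (Set.Iic u)`. -/
def IsCopula {d : ℕ} (C : Measure (Fin d → ℝ)) : Prop :=
  IsProbabilityMeasure C ∧
    ∀ i, C.map (fun u => u i) = (volume : Measure ℝ).restrict (Set.Icc 0 1)

/-- `C` is a generalized Pareto copula with corresponding D-norm `N`: for some `u₀ ∈ (0,1)^d`, its
distribution function is `1 - N (1 - u)` at every `u` in the box `[u₀, 1]`. -/
def IsGPC {d : ℕ} (C : Measure (Fin d → ℝ)) (N : (Fin d → ℝ) → ℝ) : Prop :=
  IsCopula C ∧ IsDNorm N ∧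
    ∃ u₀ : Fin d → ℝ, (∀ i, 0 < u₀ i ∧ u₀ i < 1) ∧
      ∀ u ∈ Set.Icc u₀ 1, C.real (Set.Iic u) = 1 - N (1 - u)

/-- The iterated partial derivative `∂_{i₁} (∂_{i₂} (⋯ (∂_{i_k} f)))` along the list
`[i₁, …, i_k]` of coordinates. -/
def iterPartial {d : ℕ} : List (Fin d) → ((Fin d → ℝ) → ℝ) → (Fin d → ℝ) → ℝ
  | [], f => f
  | i :: L, f => fun x => deriv (fun t => iterPartial L f (Function.update x i t)) (x i)

/-- `f` has (everywhere on the open orthant `x < 0`) the partial derivatives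
`∂^k f / ∂x_{i₁} ⋯ ∂x_{i_k}` in pairwise distinct coordinates, up to `k = d`, in any order of
differentiation. No continuity is required, no derivative with respect to the same
coordinate twice, and nothing on the hyperplanes `x_i = 0`. -/
def HasMixedPartials {d : ℕ} (f : (Fin d → ℝ) → ℝ) : Prop :=
  ∀ (i : Fin d) (L : List (Fin d)), (i :: L).Nodup → ∀ x : Fin d → ℝ, (∀ j, x j < 0) →
    DifferentiableAt ℝ (fun t => iterPartial L f (Function.update x i t)) (x i)

/-- `G` is the standard max-stable distribution with D-norm `N`: the probability measure on `ℝ^d`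
with distribution function `exp (-N x)` for `x ≤ 0` (`N 0 = 0`, so all mass lies on `x ≤ 0`). -/
def IsStdMaxStable {d : ℕ} (G : Measure (Fin d → ℝ)) (N : (Fin d → ℝ) → ℝ) : Prop :=
  IsProbabilityMeasure G ∧ ∀ x : Fin d → ℝ, x ≤ 0 → G.real (Set.Iic x) = Real.exp (-N x)

/-- The componentwise maximum of the first `n` terms `U 0 ω, …, U (n-1) ω` (for `n ≥ 1`). -/
def compMax {Ω : Type*} {d : ℕ} (U : ℕ → Ω → Fin d → ℝ) (n : ℕ) (ω : Ω) : Fin d → ℝ :=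
  fun j => ⨆ i : Fin n, U i ω j

end

/-! Fix `K > 0` and put `a = (-K, …, -K)`, `p = N a`. For large `n` a rescaled observation `n (U -
1)` exceeds `-K` in some coordinate with probability `p / n`. Given this, its law after capping
below at `a` is, by homogeneity of `N`, a measure `Λ` free of `n`. The capped normalised maximum is
therefore exactly a binomial mixture, with weights `b(k; n, p / n)`, of the laws of the maximum of
`a` and `k` independent draws from `Λ` (`map_sup_normMaxLaw_real`).

Only the weights depend on `n`, and they converge in `ℓ¹` to Poisson weights, so the mixtures
converge uniformly over all Borel sets. Capping costs at most `d e^{-K}`, also uniformly. Hence the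
laws are Cauchy in total variation (`normMaxLaw_uniformCauchy`), and completeness gives a limit. Its
distribution function on `x ≤ 0` is `lim (1 - N x / n)^n = exp (-N x)`, which proves that `G` exists
and, by uniqueness, that every such `G` is the limit. -/

/-- A finite measure on `ℝ^d` is determined by its total mass and its distribution function. -/
theorem MeasureTheory.Measure.ext_of_Iic_pi {d : ℕ} {μ ν : Measure (Fin d → ℝ)} [IsFiniteMeasure μ]
    (huniv : μ Set.univ = ν Set.univ) (h : ∀ y, μ (Set.Iic y) = ν (Set.Iic y)) : μ = ν := by
  have hgen : ∀ _ : Fin d, MeasurableSpace.generateFrom (Set.range (Set.Iic : ℝ → Set ℝ))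
      = (inferInstance : MeasurableSpace ℝ) := fun _ => by
    rw [← borel_eq_generateFrom_Iic, BorelSpace.measurable_eq (α := ℝ)]
  have hspan : ∀ _ : Fin d, IsCountablySpanning (Set.range (Set.Iic : ℝ → Set ℝ)) := fun _ =>
    ⟨fun n => Set.Iic (n : ℝ), fun n => ⟨n, rfl⟩, Set.iUnion_eq_univ_iff.2 fun x => exists_nat_ge x⟩
  refine ext_of_generate_finite _ (generateFrom_eq_pi hgen hspan).symm
    (IsPiSystem.pi fun _ => isPiSystem_Iic) ?_ huniv
  rintro _ ⟨S, hS, rfl⟩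
  choose y hy using fun i => hS i (Set.mem_univ i)
  have : S = fun i => Set.Iic (y i) := funext fun i => (hy i).symm
  rw [this, Set.pi_univ_Iic]
  exact h y

/-- Probability measures on the orthant `x ≤ 0` with the same distribution function there agree. -/
theorem MeasureTheory.Measure.ext_of_Iic_nonpos {d : ℕ} {μ ν : Measure (Fin d → ℝ)}
    [IsProbabilityMeasure μ] [IsProbabilityMeasure ν] (hμ : μ.real (Set.Iic 0) = 1)
    (h : ∀ y ≤ 0, μ.real (Set.Iic y) = ν.real (Set.Iic y)) : μ = ν := by
  have key : ∀ ρ : Measure (Fin d → ℝ), IsProbabilityMeasure ρ → ρ.real (Set.Iic 0) = 1 →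
      ∀ y, ρ.real (Set.Iic y) = ρ.real (Set.Iic (y ⊓ 0)) := by
    intro ρ _ hρ y
    have h0 : ∀ᵐ x ∂ρ, x ∈ Set.Iic (0 : Fin d → ℝ) := by
      refine (prob_compl_eq_zero_iff measurableSet_Iic).2 ?_
      rwa [measureReal_def, ENNReal.toReal_eq_one_iff] at hρ
    refine measureReal_congr ?_
    filter_upwards [h0] with x hx
    apply propext
    show x ≤ y ↔ x ≤ y ⊓ 0
    rw [le_inf_iff]
    exact ⟨fun hy => ⟨hy, hx⟩, fun hy => hy.1⟩
  refine Measure.ext_of_Iic_pi (by simp) fun y => ?_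
  rw [← measureReal_eq_measureReal_iff, key μ inferInstance hμ y,
    key ν inferInstance (h 0 le_rfl ▸ hμ) y]
  exact h _ inf_le_right

/-! ### Completeness in total variation -/

/-- Completeness of the probability measures for the total variation distance. -/
theorem exists_limit_of_uniformCauchy {α : Type*} [MeasurableSpace α] (μ : ℕ → Measure α)
    [∀ n, IsProbabilityMeasure (μ n)]
    (h : ∀ ε > 0, ∃ n₀, ∀ m ≥ n₀, ∀ n ≥ n₀, ∀ A, MeasurableSet A →
      |(μ m).real A - (μ n).real A| ≤ ε) :
    ∃ ν : Measure α, IsProbabilityMeasure ν ∧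
      ∀ ε > 0, ∀ᶠ n in atTop, ∀ A, MeasurableSet A → |(μ n).real A - ν.real A| ≤ ε := by
  have hlim : ∀ A, MeasurableSet A → ∃ l, Tendsto (fun n => (μ n).real A) atTop (𝓝 l) := by
    intro A hA
    refine cauchySeq_tendsto_of_complete (Metric.cauchySeq_iff.2 fun ε hε => ?_)
    obtain ⟨n₀, hn₀⟩ := h (ε / 2) (half_pos hε)
    exact ⟨n₀, fun m hm n hn => lt_of_le_of_lt (hn₀ m hm n hn A hA) (half_lt_self hε)⟩
  choose! L hL using hlim
  have hunif : ∀ ε > 0, ∀ᶠ n in atTop, ∀ A, MeasurableSet A → |(μ n).real A - L A| ≤ ε := by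
    intro ε hε
    obtain ⟨n₀, hn₀⟩ := h ε hε
    filter_upwards [eventually_ge_atTop n₀] with m hm A hA
    refine le_of_tendsto ((tendsto_const_nhds.sub (hL A hA)).abs) ?_
    filter_upwards [eventually_ge_atTop n₀] with n hn using hn₀ m hm n hn A hA
  have hnonneg : ∀ A, MeasurableSet A → 0 ≤ L A := fun A hA =>
    ge_of_tendsto (hL A hA) (Eventually.of_forall fun n => measureReal_nonneg)
  have hL0 : L ∅ = 0 := tendsto_nhds_unique (hL ∅ .empty) (by simp)
  have hL1 : L Set.univ = 1 := tendsto_nhds_unique (hL _ .univ) (by simp)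
  have hsum : ∀ f : ℕ → Set α, (∀ i, MeasurableSet (f i)) → Pairwise (Function.onFun Disjoint f) →
      HasSum (fun i => L (f i)) (L (⋃ i, f i)) := by
    intro f hf hd
    rw [hasSum_iff_tendsto_nat_of_nonneg fun i => hnonneg _ (hf i)]
    have hfin : ∀ n m, ∑ i ∈ Finset.range m, (μ n).real (f i)
        = (μ n).real (⋃ i ∈ Finset.range m, f i) := fun n m =>
      (measureReal_biUnion_finset (fun i _ j _ hij => hd hij) fun i _ => hf i).symm
    have hm : ∀ m, MeasurableSet (⋃ i ∈ Finset.range m, f i) := fun m =>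
      Finset.measurableSet_biUnion _ fun i _ => hf i
    have hLfin : ∀ m, ∑ i ∈ Finset.range m, L (f i) = L (⋃ i ∈ Finset.range m, f i) := fun m => by
      refine tendsto_nhds_unique (tendsto_finsetSum _ fun i _ => hL _ (hf i)) ?_
      simp_rw [hfin]
      exact hL _ (hm m)
    -- Countable additivity of `L` is an exchange of limits: a partial sum is the measure of a
    -- finite union, so the bound uniform over sets makes the convergence in `n` uniform in `m`.
    refine TendstoUniformly.tendsto_of_eventually_tendsto
      (F := fun n m => ∑ i ∈ Finset.range m, (μ n).real (f i)) (p := atTop)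
      (L := fun n => (μ n).real (⋃ i, f i)) ?_ (Eventually.of_forall fun n => ?_)
      (hL _ (.iUnion hf))
    · refine Metric.tendstoUniformly_iff.2 fun ε hε => ?_
      filter_upwards [hunif (ε / 2) (half_pos hε)] with n hn m
      rw [dist_comm, hfin, hLfin]
      exact lt_of_le_of_lt (hn _ (hm m)) (half_lt_self hε)
    · have hs : HasSum (fun i => (μ n).real (f i)) ((μ n).real (⋃ i, f i)) := by
        have hne : ∑' i, (μ n) (f i) ≠ ⊤ := by
          rw [← measure_iUnion hd hf]
          exact measure_ne_top _ _
        rw [measureReal_def, measure_iUnion hd hf, ENNReal.tsum_toReal_eq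
          fun i => measure_ne_top _ _]
        exact (ENNReal.summable_toReal hne).hasSum
      exact hs.tendsto_sum_nat
  let ν : Measure α := Measure.ofMeasurable (fun A _ => ENNReal.ofReal (L A)) (by simp [hL0])
    (fun f hf hd => by
      rw [← (hsum f hf hd).tsum_eq, ENNReal.ofReal_tsum_of_nonneg (fun i => hnonneg _ (hf i))
        (hsum f hf hd).summable])
  have hν : ∀ A, MeasurableSet A → ν A = ENNReal.ofReal (L A) := fun A hA =>
    Measure.ofMeasurable_apply A hA
  refine ⟨ν, ⟨by rw [hν _ .univ, hL1, ENNReal.ofReal_one]⟩, fun ε hε => ?_⟩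
  filter_upwards [hunif ε hε] with n hn A hA
  rw [measureReal_def ν, hν A hA, ENNReal.toReal_ofReal (hnonneg A hA)]
  exact hn A hA

/-! ### Poisson approximation in `ℓ¹` -/

/-- The binomial weight `b(k; n, p / n)`. -/
noncomputable def rareBinomial (p : ℝ) (n k : ℕ) : ℝ :=
  n.choose k * (p / n) ^ k * (1 - p / n) ^ (n - k)

/-- Poisson convergence of binomial distributions holds in `ℓ¹`. -/
theorem tendsto_tsum_abs_rareBinomial_sub {p : ℝ} (hp : 0 ≤ p) :
    Tendsto (fun n => ∑' k, |rareBinomial p n k - Real.exp (-p) * p ^ k / k.factorial|)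
      atTop (𝓝 0) := by
  have hs : Summable fun k : ℕ => p ^ k / k.factorial := Real.summable_pow_div_factorial p
  have hb := (hs.add (hs.mul_left (Real.exp (-p))))
  have := tendsto_tsum_of_dominated_convergence (𝓕 := atTop) (g := fun _ : ℕ => (0 : ℝ))
    (f := fun n k => |rareBinomial p n k - Real.exp (-p) * p ^ k / k.factorial|) hb ?_ ?_
  · simpa using this
  · intro k
    have hlim : Tendsto (fun n => rareBinomial p n k) atTop
        (𝓝 (Real.exp (-p) * p ^ k / k.factorial)) := by
      refine tendsto_choose_mul_pow_of_tendsto_mul_atTop (p := fun n : ℕ => p / n) k ?_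
      refine tendsto_const_nhds.congr' ?_
      filter_upwards [eventually_ge_atTop 1] with n hn
      have : (n : ℝ) ≠ 0 := by positivity
      field_simp
    simpa using (hlim.sub_const (Real.exp (-p) * p ^ k / k.factorial)).abs
  -- Once `p / n ≤ 1` the binomial weight is at most `p ^ k / k!`, a summable bound independent of
  -- `n`.
  · filter_upwards [eventually_ge_atTop 1, eventually_ge_atTop ⌈p⌉₊] with n hn hpn k
    have hn0 : (0 : ℝ) < n := by positivity
    have hpn' : p / n ≤ 1 := (div_le_one hn0).2 (Nat.ceil_le.1 hpn)
    have h1 : 0 ≤ 1 - p / n := by linarith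
    have h2 : 1 - p / n ≤ 1 := by linarith [div_nonneg hp hn0.le]
    have hle : rareBinomial p n k ≤ p ^ k / k.factorial := by
      calc rareBinomial p n k ≤ ((n : ℝ) ^ k / k.factorial) * (p / n) ^ k * 1 := by
            unfold rareBinomial
            gcongr
            · exact Nat.choose_le_pow_div k n
            · exact pow_le_one₀ h1 h2
        _ = p ^ k / k.factorial := by rw [div_pow]; field_simp
    have hge : 0 ≤ rareBinomial p n k := by unfold rareBinomial; positivity
    have hge' : 0 ≤ Real.exp (-p) * (p ^ k / k.factorial) := by positivity
    rw [Real.norm_eq_abs, abs_abs, mul_div_assoc, abs_le]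
    constructor <;> linarith [hge.trans hle]

theorem summable_abs_rareBinomial_sub {p : ℝ} (n : ℕ) :
    Summable fun k => |rareBinomial p n k - Real.exp (-p) * p ^ k / k.factorial| := by
  refine Summable.abs (Summable.sub ?_ ?_)
  · refine summable_of_ne_finset_zero (s := Finset.range (n + 1)) fun k hk => ?_
    rw [Finset.mem_range, not_lt] at hk
    simp [rareBinomial, Nat.choose_eq_zero_of_lt hk]
  · simp_rw [mul_div_assoc]
    exact (Real.summable_pow_div_factorial p).mul_left _

/-- Binomial mixtures of a fixed sequence of numbers in `[0, 1]` are close to Poisson mixtures. -/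
theorem abs_sum_rareBinomial_sub_le {p : ℝ} (n : ℕ) {v : ℕ → ℝ} (h0 : ∀ k, 0 ≤ v k)
    (h1 : ∀ k, v k ≤ 1) :
    |∑ k ∈ Finset.range (n + 1), rareBinomial p n k * v k
      - ∑' k : ℕ, Real.exp (-p) * p ^ k / k.factorial * v k|
      ≤ ∑' k, |rareBinomial p n k - Real.exp (-p) * p ^ k / k.factorial| := by
  have hv : ∀ k, ‖v k‖ ≤ 1 := fun k => by rw [Real.norm_of_nonneg (h0 k)]; exact h1 k
  have hfin : HasSum (fun k => rareBinomial p n k * v k)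
      (∑ k ∈ Finset.range (n + 1), rareBinomial p n k * v k) := by
    refine hasSum_sum_of_ne_finset_zero fun k hk => ?_
    rw [Finset.mem_range, not_lt] at hk
    simp [rareBinomial, Nat.choose_eq_zero_of_lt hk]
  have hpoi : Summable fun k : ℕ => Real.exp (-p) * p ^ k / k.factorial * v k := by
    have hs : Summable fun k : ℕ => ‖Real.exp (-p) * p ^ k / k.factorial‖ := by
      simp_rw [mul_div_assoc]
      exact ((Real.summable_pow_div_factorial p).mul_left _).norm
    refine Summable.of_norm_bounded hs fun k => ?_
    rw [norm_mul]
    exact mul_le_of_le_one_right (norm_nonneg _) (hv k)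
  rw [← (hfin.sub hpoi.hasSum).tsum_eq, ← Real.norm_eq_abs]
  refine tsum_of_norm_bounded (summable_abs_rareBinomial_sub n).hasSum fun k => ?_
  rw [← sub_mul, norm_mul]
  exact mul_le_of_le_one_right (norm_nonneg _) (hv k)

/-! ### Convolution powers for the maximum -/

theorem Measurable.sup_pi {α : Type*} [MeasurableSpace α] {d : ℕ} {f g : α → Fin d → ℝ}
    (hf : Measurable f) (hg : Measurable g) : Measurable fun x => f x ⊔ g x :=
  measurable_pi_lambda _ fun i => ((measurable_pi_apply i).comp hf).sup
    ((measurable_pi_apply i).comp hg)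

/-- The `k`-fold convolution power of `Λ` for the componentwise maximum, started at `a`. -/
noncomputable def supPow {d : ℕ} (a : Fin d → ℝ) (Λ : Measure (Fin d → ℝ)) :
    ℕ → Measure (Fin d → ℝ)
  | 0 => Measure.dirac a
  | k + 1 => ((supPow a Λ k).prod Λ).map fun z => z.1 ⊔ z.2

instance {d : ℕ} (a : Fin d → ℝ) (Λ : Measure (Fin d → ℝ)) [IsProbabilityMeasure Λ] (k : ℕ) :
    IsProbabilityMeasure (supPow a Λ k) := by
  induction k with
  | zero => exact Measure.dirac.isProbabilityMeasure
  | succ k ih =>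
    exact Measure.isProbabilityMeasure_map (measurable_fst.sup_pi measurable_snd).aemeasurable

/-- A maximum is `≤ y` exactly when every term is, so distribution functions multiply; the Dirac
factor is the indicator of `a ≤ y`. -/
theorem supPow_real_Iic {d : ℕ} (a : Fin d → ℝ) (Λ : Measure (Fin d → ℝ)) [IsProbabilityMeasure Λ]
    (k : ℕ) (y : Fin d → ℝ) :
    (supPow a Λ k).real (Set.Iic y)
      = (Measure.dirac a).real (Set.Iic y) * Λ.real (Set.Iic y) ^ k := by
  induction k with
  | zero => simp [supPow]
  | succ k ih =>
    have : (fun z : (Fin d → ℝ) × (Fin d → ℝ) => z.1 ⊔ z.2) ⁻¹' Set.Iic y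
        = Set.Iic y ×ˢ Set.Iic y := by
      ext z; exact sup_le_iff (α := Fin d → ℝ)
    rw [supPow, map_measureReal_apply (measurable_fst.sup_pi measurable_snd) measurableSet_Iic,
      this, measureReal_prod_prod, ih, pow_succ, mul_assoc]

/-! ### D-norms and generalized Pareto copulas near the upper corner -/

theorem IsDNorm.map_neg_smul {d : ℕ} {N : (Fin d → ℝ) → ℝ} (hN : IsDNorm N) {c : ℝ} (hc : 0 ≤ c)
    (x : Fin d → ℝ) : N (-(c • x)) = c * N x := by
  obtain ⟨ν, -, -, -, h⟩ := hN
  rw [h, h, ← integral_const_mul]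
  refine integral_congr_ae (Eventually.of_forall fun z => ?_)
  simp only [Pi.neg_apply, Pi.smul_apply, smul_eq_mul, abs_neg, abs_mul, abs_of_nonneg hc]
  rw [Real.mul_iSup_of_nonneg hc]
  simp_rw [mul_assoc]

theorem IsDNorm.map_zero {d : ℕ} {N : (Fin d → ℝ) → ℝ} (hN : IsDNorm N) : N 0 = 0 := by
  simpa using hN.map_neg_smul le_rfl 0

/-- The threshold for `n` depends on `K` only: it puts the whole box `[1 - K / n, 1]` inside `[u₀,
1]`. Homogeneity then extracts the factor `1 / n`. -/
theorem IsGPC.eventually_real_Iic {d : ℕ} {C : Measure (Fin d → ℝ)} {N : (Fin d → ℝ) → ℝ}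
    (hC : IsGPC C N) (K : ℝ) : ∀ᶠ n : ℕ in atTop, ∀ y : Fin d → ℝ, (fun _ => -K) ≤ y → y ≤ 0 →
      C.real (Set.Iic (1 + (n : ℝ)⁻¹ • y)) = 1 - N y / n := by
  obtain ⟨-, hN, u₀, hu₀, h⟩ := hC
  have hlim : Tendsto (fun n : ℕ => (n : ℝ)⁻¹ * K) atTop (𝓝 0) := by
    simpa using (tendsto_inv_atTop_nhds_zero_nat (𝕜 := ℝ)).mul_const K
  have hev : ∀ᶠ n : ℕ in atTop, ∀ i, (n : ℝ)⁻¹ * K < 1 - u₀ i :=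
    eventually_all.2 fun i => hlim.eventually_lt_const (by linarith [(hu₀ i).2])
  filter_upwards [hev] with n hn y hKy hy
  have hinv : (0 : ℝ) ≤ (n : ℝ)⁻¹ := by positivity
  rw [h _ ⟨fun i => ?_, fun i => ?_⟩]
  · rw [sub_add_cancel_left, hN.map_neg_smul hinv, div_eq_inv_mul]
  · have h1 := mul_le_mul_of_nonneg_left (hKy i) hinv
    have h2 := hn i
    simp only [Pi.add_apply, Pi.one_apply, Pi.smul_apply, smul_eq_mul]
    linarith
  · have h1 := mul_nonpos_of_nonneg_of_nonpos hinv (hy i)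
    simp only [Pi.add_apply, Pi.one_apply, Pi.smul_apply, smul_eq_mul]
    linarith

theorem IsCopula.real_le {d : ℕ} {C : Measure (Fin d → ℝ)} (hC : IsCopula C) (j : Fin d) {t : ℝ}
    (h0 : 0 ≤ t) (h1 : t ≤ 1) : C.real {u | u j ≤ t} = t := by
  have h := congrArg (fun μ : Measure ℝ => μ.real (Set.Iic t)) (hC.2 j)
  rw [map_measureReal_apply (measurable_pi_apply j) measurableSet_Iic,
    measureReal_restrict_apply measurableSet_Iic] at h
  have hset : Set.Iic t ∩ Set.Icc 0 1 = Set.Icc 0 t := by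
    ext x
    simp only [Set.mem_inter_iff, Set.mem_Iic, Set.mem_Icc]
    exact ⟨fun h => ⟨h.2.1, h.1⟩, fun h => ⟨h.2, h.1, h.2.trans h1⟩⟩
  rw [hset, Real.volume_real_Icc_of_le h0, sub_zero] at h
  exact h

/-- The D-norm dominates the supremum norm. -/
theorem IsGPC.le_of_const {d : ℕ} {C : Measure (Fin d → ℝ)} {N : (Fin d → ℝ) → ℝ}
    (hC : IsGPC C N) (hd : 0 < d) {K : ℝ} (hK : 0 ≤ K) : K ≤ N fun _ => -K := by
  have := hC.1.1
  obtain ⟨n, hn, hn1, hnK⟩ := ((hC.eventually_real_Iic K).and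
    ((eventually_ge_atTop 1).and (eventually_ge_atTop ⌈K⌉₊))).exists
  have hn0 : (0 : ℝ) < n := by positivity
  have hKn : K / n ≤ 1 := (div_le_one hn0).2 (Nat.ceil_le.1 hnK)
  have hKn0 : 0 ≤ K / n := by positivity
  have h1 := hn (fun _ => -K) le_rfl fun _ => by simpa using hK
  have h2 := hC.1.real_le ⟨0, hd⟩ (t := 1 - K / n) (by linarith) (by linarith)
  -- The joint distribution function is bounded by a uniform margin: `1 - N a / n ≤ 1 - K / n`.
  have h3 : C.real (Set.Iic (1 + (n : ℝ)⁻¹ • fun _ => -K)) ≤ C.real {u | u ⟨0, hd⟩ ≤ 1 - K / n} := by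
    refine measureReal_mono fun u hu => ?_
    have := hu ⟨0, hd⟩
    simp only [Pi.add_apply, Pi.one_apply, Pi.smul_apply, smul_eq_mul] at this
    show u ⟨0, hd⟩ ≤ 1 - K / n
    rw [div_eq_inv_mul]
    linarith
  rw [h1, h2] at h3
  have : K / n ≤ N (fun _ => -K) / n := by linarith
  exact (div_le_div_iff_of_pos_right hn0).1 this

/-- The renormalised law of a rescaled observation with generalized Pareto copula, conditioned on
exceeding the level `-K` in some coordinate and capped below at `-K`. -/
theorem IsGPC.exists_exceedance_law {d : ℕ} {C : Measure (Fin d → ℝ)} {N : (Fin d → ℝ) → ℝ}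
    (hC : IsGPC C N) (hd : 0 < d) {K : ℝ} (hK : 0 < K) :
    ∃ Λ : Measure (Fin d → ℝ), IsProbabilityMeasure Λ ∧ ∀ y : Fin d → ℝ, (fun _ => -K) ≤ y →
      y ≤ 0 → Λ.real (Set.Iic y) = (N (fun _ => -K) - N y) / N fun _ => -K := by
  have := hC.1.1
  have hp : 0 < N fun _ => -K := hK.trans_le (hC.le_of_const hd hK.le)
  -- Any one large `n` serves, since `n` cancels from the conditional law.
  obtain ⟨n, hn, hn1⟩ := ((hC.eventually_real_Iic K).and (eventually_ge_atTop 1)).exists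
  have hn0 : (0 : ℝ) < n := by positivity
  set a : Fin d → ℝ := fun _ => -K with ha
  have ha0 : a ≤ 0 := fun _ => by simpa [ha] using hK.le
  have hTm : Measurable fun u : Fin d → ℝ => a ⊔ (n : ℝ) • (u - 1) :=
    measurable_const.sup_pi ((measurable_id.sub_const 1).const_smul (n : ℝ))
  set V : Measure (Fin d → ℝ) := C.map fun u => a ⊔ (n : ℝ) • (u - 1) with hV
  have : IsProbabilityMeasure V := Measure.isProbabilityMeasure_map hTm.aemeasurable
  have hVy : ∀ y, a ≤ y → y ≤ 0 → V.real (Set.Iic y) = 1 - N y / n := by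
    intro y hay hy0
    rw [← hn y hay hy0, hV, map_measureReal_apply hTm measurableSet_Iic]
    congr 1
    ext u
    simp only [Set.mem_preimage, Set.mem_Iic, sup_le_iff, hay, true_and, Pi.le_def]
    refine forall_congr' fun i => ?_
    simp only [Pi.add_apply, Pi.one_apply, Pi.smul_apply, smul_eq_mul, Pi.sub_apply]
    rw [← div_eq_inv_mul, ← sub_le_iff_le_add', le_div_iff₀' hn0]
  -- Capping gathers all non-exceedances into an atom at `a`, so conditioning on `{a}ᶜ` is
  -- conditioning on an exceedance.
  have hVa : V.real {a} = 1 - N a / n := by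
    rw [← hVy a le_rfl ha0, hV, map_measureReal_apply hTm measurableSet_Iic,
      map_measureReal_apply hTm (measurableSet_singleton a)]
    congr 1
    ext u
    exact ⟨fun h => le_of_eq h, fun h => le_antisymm h le_sup_left⟩
  have hVac : V.real {a}ᶜ = N a / n := by
    rw [probReal_compl_eq_one_sub (measurableSet_singleton a), hVa, sub_sub_cancel]
  have hne : V {a}ᶜ ≠ 0 := fun h => by
    rw [measureReal_def, h, ENNReal.toReal_zero] at hVac
    exact (div_pos hp hn0).ne hVac
  refine ⟨V[|{a}ᶜ], cond_isProbabilityMeasure hne, fun y hay hy0 => ?_⟩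
  rw [measureReal_def, cond_apply (measurableSet_singleton a).compl, ENNReal.toReal_mul,
    ENNReal.toReal_inv, ← measureReal_def, ← measureReal_def, hVac, Set.inter_comm, ← Set.sdiff_eq,
    measureReal_sdiff (Set.singleton_subset_iff.2 hay) (measurableSet_singleton a), hVa,
    hVy y hay hy0]
  field_simp
  ring

/-! ### Laws of the normalised maxima -/

theorem compMax_apply_le_iff {Ω : Type*} {d : ℕ} {U : ℕ → Ω → Fin d → ℝ} {n : ℕ} (hn : 0 < n)
    (ω : Ω) (j : Fin d) (t : ℝ) :
    compMax U n ω j ≤ t ↔ ∀ i : Fin n, U i ω j ≤ t := by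
  have : Nonempty (Fin n) := ⟨⟨0, hn⟩⟩
  exact ciSup_le_iff (Set.finite_range _).bddAbove

theorem normMax_apply_le_iff {Ω : Type*} {d : ℕ} {U : ℕ → Ω → Fin d → ℝ} {n : ℕ} (hn : 0 < n)
    (ω : Ω) (j : Fin d) (t : ℝ) :
    ((n : ℝ) • (compMax U n ω - 1)) j ≤ t ↔ ∀ i : Fin n, U i ω j ≤ 1 + (n : ℝ)⁻¹ * t := by
  have hn0 : (0 : ℝ) < n := by positivity
  rw [← compMax_apply_le_iff hn]
  simp only [Pi.one_apply, Pi.smul_apply, smul_eq_mul, Pi.sub_apply]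
  rw [← div_eq_inv_mul, ← sub_le_iff_le_add', le_div_iff₀' hn0]

section Maxima

variable {Ω : Type*} [MeasurableSpace Ω] {P : Measure Ω} {d : ℕ} {C : Measure (Fin d → ℝ)}
  {N : (Fin d → ℝ) → ℝ} {U : ℕ → Ω → Fin d → ℝ}

theorem iIndepFun.real_forall_mem [IsProbabilityMeasure P] (hUmeas : ∀ i, Measurable (U i))
    (hUindep : iIndepFun U P) (hUlaw : ∀ i, P.map (U i) = C) (n : ℕ) {S : Set (Fin d → ℝ)}
    (hS : MeasurableSet S) : P.real {ω | ∀ i : Fin n, U i ω ∈ S} = C.real S ^ n := by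
  have h := hUindep.measure_inter_preimage_eq_mul (Finset.range n) (sets := fun _ => S)
    fun _ _ => hS
  have hset : {ω | ∀ i : Fin n, U i ω ∈ S} = ⋂ i ∈ Finset.range n, U i ⁻¹' S := by
    ext ω
    simp [Fin.forall_iff]
  rw [hset, measureReal_def, h, ENNReal.toReal_prod]
  have : ∀ i, (P (U i ⁻¹' S)).toReal = C.real S := fun i => by
    rw [← hUlaw i, map_measureReal_apply (hUmeas i) hS, measureReal_def]
  simp [this]

theorem measurable_compMax (hUmeas : ∀ i, Measurable (U i)) (n : ℕ) :
    Measurable (compMax U n) :=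
  measurable_pi_lambda _ fun j => Measurable.iSup fun i =>
    (measurable_pi_apply j).comp (hUmeas i)

/-- The law of the normalised maximum `n (M⁽ⁿ⁾ - 1)`. -/
noncomputable def normMaxLaw (P : Measure Ω) (U : ℕ → Ω → Fin d → ℝ) (n : ℕ) :
    Measure (Fin d → ℝ) :=
  P.map fun ω => (n : ℝ) • (compMax U n ω - 1)

theorem measurable_normMax (hUmeas : ∀ i, Measurable (U i)) (n : ℕ) :
    Measurable fun ω => (n : ℝ) • (compMax U n ω - 1) :=
  ((measurable_compMax hUmeas n).sub_const 1).const_smul (n : ℝ)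

theorem normMaxLaw_real_Iic [IsProbabilityMeasure P] (hUmeas : ∀ i, Measurable (U i))
    (hUindep : iIndepFun U P) (hUlaw : ∀ i, P.map (U i) = C) {n : ℕ} (hn : 0 < n)
    (y : Fin d → ℝ) :
    (normMaxLaw P U n).real (Set.Iic y) = C.real (Set.Iic (1 + (n : ℝ)⁻¹ • y)) ^ n := by
  rw [← iIndepFun.real_forall_mem hUmeas hUindep hUlaw n measurableSet_Iic, normMaxLaw,
    map_measureReal_apply (measurable_normMax hUmeas n) measurableSet_Iic]
  congr 1
  ext ω
  simp only [Set.mem_preimage, Set.mem_Iic, Set.mem_ofPred_eq]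
  rw [Pi.le_def]
  simp_rw [normMax_apply_le_iff hn]
  exact forall_comm

/-- Some coordinate of `n (M⁽ⁿ⁾ - 1)` falls below `-K` with probability at most `d e^{-K}`. -/
theorem normMaxLaw_real_compl_Ici_le [IsProbabilityMeasure P] (hUmeas : ∀ i, Measurable (U i))
    (hUindep : iIndepFun U P) (hUlaw : ∀ i, P.map (U i) = C) (hC : IsCopula C) {n : ℕ}
    (hn : 0 < n) {K : ℝ} (hK : 0 ≤ K) (hKn : K ≤ n) :
    (normMaxLaw P U n).real (Set.Ici fun _ => -K)ᶜ ≤ d * Real.exp (-K) := by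
  have hn0 : (0 : ℝ) < n := by positivity
  have hone : K / n ≤ 1 := (div_le_one hn0).2 hKn
  have hnn : 0 ≤ K / n := by positivity
  have hm : ∀ j, MeasurableSet {u : Fin d → ℝ | u j ≤ 1 - K / n} := fun j =>
    measurableSet_le (measurable_pi_apply j) measurable_const
  rw [normMaxLaw, map_measureReal_apply (measurable_normMax hUmeas n) measurableSet_Ici.compl]
  calc P.real ((fun ω => (n : ℝ) • (compMax U n ω - 1)) ⁻¹' (Set.Ici fun _ => -K)ᶜ)
      ≤ P.real (⋃ j : Fin d, {ω | ∀ i : Fin n, U i ω ∈ {u : Fin d → ℝ | u j ≤ 1 - K / n}}) := by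
        refine measureReal_mono fun ω hω => ?_
        simp only [Set.mem_preimage, Set.mem_compl_iff, Set.mem_Ici, Pi.le_def, not_forall,
          not_le] at hω
        obtain ⟨j, hj⟩ := hω
        refine Set.mem_iUnion.2 ⟨j, fun i => ?_⟩
        have := (normMax_apply_le_iff hn ω j (-K)).1 hj.le i
        show U i ω j ≤ 1 - K / n
        rw [div_eq_inv_mul]
        linarith
    _ ≤ ∑ j : Fin d, P.real {ω | ∀ i : Fin n, U i ω ∈ {u : Fin d → ℝ | u j ≤ 1 - K / n}} :=
        measureReal_iUnion_fintype_le _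
    _ = ∑ j : Fin d, (1 - K / n) ^ n := by
        refine Finset.sum_congr rfl fun j _ => ?_
        rw [iIndepFun.real_forall_mem hUmeas hUindep hUlaw n (hm j),
          hC.real_le j (by linarith) (by linarith)]
    _ ≤ d * Real.exp (-K) := by
        rw [Finset.sum_const, Finset.card_univ, Fintype.card_fin, nsmul_eq_mul]
        gcongr
        exact Real.one_sub_div_pow_le_exp_neg hKn

/-- The normalised maximum capped below at `-K` is a binomial mixture of sup-convolution powers. -/
theorem map_sup_normMaxLaw_real [IsProbabilityMeasure P] (hUmeas : ∀ i, Measurable (U i))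
    (hUindep : iIndepFun U P) (hUlaw : ∀ i, P.map (U i) = C) (hC : IsGPC C N) {K p : ℝ}
    {a : Fin d → ℝ} (ha : a = fun _ => -K) (hK : 0 ≤ K) (hp0 : 0 < p)
    {Λ : Measure (Fin d → ℝ)} [IsProbabilityMeasure Λ]
    (hΛ : ∀ y, a ≤ y → y ≤ 0 → Λ.real (Set.Iic y) = (p - N y) / p) :
    ∀ᶠ n : ℕ in atTop, ∀ A, MeasurableSet A →
      ((normMaxLaw P U n).map fun x => a ⊔ x).real A
        = ∑ k ∈ Finset.range (n + 1), rareBinomial p n k * (supPow a Λ k).real A := by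
  filter_upwards [hC.eventually_real_Iic K, eventually_ge_atTop 1, eventually_ge_atTop ⌈p⌉₊]
    with n hn hn1 hpn
  have hn0 : (0 : ℝ) < n := by positivity
  have hpn' : p / n ≤ 1 := (div_le_one hn0).2 (Nat.ceil_le.1 hpn)
  have hw : ∀ k, 0 ≤ rareBinomial p n k := fun k => by
    have : 0 ≤ 1 - p / n := by linarith
    unfold rareBinomial
    positivity
  have ha0 : a ≤ 0 := fun i => by simpa [ha] using hK
  have hsupm : Measurable fun x : Fin d → ℝ => a ⊔ x := measurable_const.sup_pi measurable_id
  have : IsProbabilityMeasure (normMaxLaw P U n) :=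
    Measure.isProbabilityMeasure_map (measurable_normMax hUmeas n).aemeasurable
  set Q := (normMaxLaw P U n).map fun x => a ⊔ x with hQ
  have : IsProbabilityMeasure Q := Measure.isProbabilityMeasure_map hsupm.aemeasurable
  set R : Measure (Fin d → ℝ) :=
    ∑ k ∈ Finset.range (n + 1), ENNReal.ofReal (rareBinomial p n k) • supPow a Λ k with hR
  have hRA : ∀ A, R A
      = ENNReal.ofReal (∑ k ∈ Finset.range (n + 1), rareBinomial p n k * (supPow a Λ k).real A) := by
    intro A
    rw [hR, Measure.finsetSum_apply, ENNReal.ofReal_sum_of_nonneg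
      fun k _ => mul_nonneg (hw k) measureReal_nonneg]
    refine Finset.sum_congr rfl fun k _ => ?_
    rw [Measure.smul_apply, smul_eq_mul, ENNReal.ofReal_mul (hw k), ofReal_measureReal]
  have hRr : ∀ A, R.real A
      = ∑ k ∈ Finset.range (n + 1), rareBinomial p n k * (supPow a Λ k).real A := fun A => by
    rw [measureReal_def, hRA, ENNReal.toReal_ofReal
      (Finset.sum_nonneg fun k _ => mul_nonneg (hw k) measureReal_nonneg)]
  -- With `s = (p - N y) / p` the base on the right is `1 - N y / n`, the distribution function of
  -- one rescaled observation.
  have hbinom : ∀ s : ℝ, ∑ k ∈ Finset.range (n + 1), rareBinomial p n k * s ^ k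
      = (p / n * s + (1 - p / n)) ^ n := fun s => by
    rw [add_pow]
    refine Finset.sum_congr rfl fun k _ => ?_
    rw [rareBinomial, mul_pow]
    ring
  have hRprob : IsProbabilityMeasure R := ⟨by
    rw [hRA]
    have := hbinom 1
    simp only [one_pow, mul_one, add_sub_cancel] at this
    simp [this]⟩
  have hNa : ∀ y, a ≤ y → y ≤ 0 → R.real (Set.Iic y) = (1 - N y / n) ^ n := by
    intro y hay hy0
    rw [hRr]
    simp_rw [supPow_real_Iic, hΛ y hay hy0]
    have : (Measure.dirac a).real (Set.Iic y) = 1 := by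
      simp [measureReal_def, hay]
    simp_rw [this, one_mul]
    rw [hbinom]
    congr 1
    field_simp
    ring
  have hQy : ∀ y, a ≤ y → y ≤ 0 → Q.real (Set.Iic y) = (1 - N y / n) ^ n := by
    intro y hay hy0
    rw [hQ, map_measureReal_apply hsupm measurableSet_Iic]
    have : (fun x => a ⊔ x) ⁻¹' Set.Iic y = Set.Iic y := by
      ext x
      simp [hay]
    rw [this, normMaxLaw_real_Iic hUmeas hUindep hUlaw hn1, hn y (ha ▸ hay) hy0]
  have hQR : Q = R := by
    refine Measure.ext_of_Iic_nonpos ?_ fun y hy0 => ?_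
    · rw [hQy 0 ha0 le_rfl, hC.2.1.map_zero]
      simp
    -- Both measures live on `x ≥ a`, so both sides vanish unless `a ≤ y`.
    · by_cases hay : a ≤ y
      · rw [hQy y hay hy0, hNa y hay hy0]
      · rw [hRr]
        simp_rw [supPow_real_Iic]
        have hd : (Measure.dirac a).real (Set.Iic y) = 0 := by
          simp [measureReal_def, hay]
        have hpre : (fun x => a ⊔ x) ⁻¹' Set.Iic y = ∅ := by
          ext x
          simp [hay]
        rw [hQ, map_measureReal_apply hsupm measurableSet_Iic, hpre]
        simp [hd]
  intro A _
  rw [hQR, hRr]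

/-- The laws of the normalised maxima form a Cauchy sequence in total variation. -/
theorem normMaxLaw_uniformCauchy [IsProbabilityMeasure P] (hUmeas : ∀ i, Measurable (U i))
    (hUindep : iIndepFun U P) (hUlaw : ∀ i, P.map (U i) = C) (hC : IsGPC C N) (hd : 0 < d)
    {ε : ℝ} (hε : 0 < ε) : ∃ n₀, ∀ m ≥ n₀, ∀ n ≥ n₀, ∀ A, MeasurableSet A →
      |(normMaxLaw P U m).real A - (normMaxLaw P U n).real A| ≤ ε := by
  have hexp : Tendsto (fun K : ℝ => d * Real.exp (-K)) atTop (𝓝 0) := by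
    simpa using Real.tendsto_exp_neg_atTop_nhds_zero.const_mul (d : ℝ)
  -- Each law is within `ε / 4` (capping) plus `ε / 4` (Poisson error) of one Poisson mixture; two
  -- such laws differ by at most `ε`.
  obtain ⟨K, hKε, hK⟩ := ((hexp.eventually_lt_const (show 0 < ε / 4 by positivity)).and
    (eventually_gt_atTop 0)).exists
  set a : Fin d → ℝ := fun _ => -K with ha
  obtain ⟨Λ, _, hΛ⟩ := hC.exists_exceedance_law hd hK
  have hp : 0 < N a := hK.trans_le (hC.le_of_const hd hK.le)
  have hpoi := tendsto_tsum_abs_rareBinomial_sub hp.le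
  obtain ⟨n₀, hn₀⟩ := eventually_atTop.1
    ((map_sup_normMaxLaw_real hUmeas hUindep hUlaw hC ha hK.le hp hΛ).and
      ((hpoi.eventually_lt_const (show 0 < ε / 4 by positivity)).and
        ((eventually_ge_atTop 1).and (eventually_ge_atTop ⌈K⌉₊))))
  have key : ∀ n ≥ n₀, ∀ A, MeasurableSet A → |(normMaxLaw P U n).real A
      - ∑' k : ℕ, Real.exp (-N a) * N a ^ k / k.factorial * (supPow a Λ k).real A| ≤ ε / 2 := by
    intro n hn A hA
    obtain ⟨hmix, hl1, hn1, hKn⟩ := hn₀ n hn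
    have : IsProbabilityMeasure (normMaxLaw P U n) :=
      Measure.isProbabilityMeasure_map (measurable_normMax hUmeas n).aemeasurable
    have hsupm : Measurable fun x : Fin d → ℝ => a ⊔ x := measurable_const.sup_pi measurable_id
    have htail := normMaxLaw_real_compl_Ici_le hUmeas hUindep hUlaw hC.1 hn1 hK.le
      (Nat.ceil_le.1 hKn)
    -- Capping moves only points outside `Set.Ici a`.
    have h1 : |(normMaxLaw P U n).real A - ((normMaxLaw P U n).map fun x => a ⊔ x).real A|
        ≤ (normMaxLaw P U n).real (Set.Ici a)ᶜ := by
      rw [map_measureReal_apply hsupm hA]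
      refine (abs_measureReal_sub_le_measureReal_symmDiff hA.nullMeasurableSet
        (hsupm hA).nullMeasurableSet).trans ?_
      refine measureReal_mono fun x hx hax => ?_
      have hsup : a ⊔ x = x := sup_eq_right.2 hax
      simp [Set.mem_symmDiff, hsup] at hx
    have h2 := abs_sum_rareBinomial_sub_le (p := N a) n (v := fun k => (supPow a Λ k).real A)
      (fun _ => measureReal_nonneg) fun _ => measureReal_le_one
    rw [← hmix A hA] at h2
    have := abs_sub_le ((normMaxLaw P U n).real A)
      (((normMaxLaw P U n).map fun x => a ⊔ x).real A)
      (∑' k : ℕ, Real.exp (-N a) * N a ^ k / k.factorial * (supPow a Λ k).real A)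
    linarith
  refine ⟨n₀, fun m hm n hn A hA => ?_⟩
  have h1 := key m hm A hA
  have h2 := key n hn A hA
  rw [abs_le] at h1 h2 ⊢
  constructor <;> linarith [h1.1, h1.2, h2.1, h2.2]

end Maxima

-- The total variation limit is reached by comparing binomial and Poisson mixtures of measures
-- directly, without densities, so that the differentiability hypothesis `hN` is not needed.
theorem mainTheorem1 {Ω : Type*} [MeasurableSpace Ω] (P : Measure Ω) [IsProbabilityMeasure P]
    (d : ℕ) (hd : 2 ≤ d)
    (C : Measure (Fin d → ℝ)) (N : (Fin d → ℝ) → ℝ)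
    (hC : IsGPC C N) (hN : HasMixedPartials N)
    (U : ℕ → Ω → Fin d → ℝ) (hUmeas : ∀ i, Measurable (U i))
    (hUindep : iIndepFun U P) (hUlaw : ∀ i, P.map (U i) = C) :
    (∃ G : Measure (Fin d → ℝ), IsStdMaxStable G N) ∧
    ∀ G : Measure (Fin d → ℝ), IsStdMaxStable G N →
      Tendsto
        (fun n : ℕ => ⨆ A : {A : Set (Fin d → ℝ) // MeasurableSet A},
          |P.real {ω | (n : ℝ) • (compMax U n ω - 1) ∈ A.1} - G.real A.1|)
        atTop (𝓝 0) := by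
  have hprob : ∀ n, IsProbabilityMeasure (normMaxLaw P U n) := fun n =>
    Measure.isProbabilityMeasure_map (measurable_normMax hUmeas n).aemeasurable
  obtain ⟨G₀, hG₀, hlim⟩ := exists_limit_of_uniformCauchy (normMaxLaw P U) fun ε hε =>
    normMaxLaw_uniformCauchy hUmeas hUindep hUlaw hC (by omega) hε
  have hcdf : ∀ x ≤ 0, G₀.real (Set.Iic x) = Real.exp (-N x) := by
    intro x hx
    have h1 : Tendsto (fun n => (normMaxLaw P U n).real (Set.Iic x)) atTop
        (𝓝 (G₀.real (Set.Iic x))) := by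
      refine Metric.tendsto_nhds.2 fun ε hε => ?_
      filter_upwards [hlim (ε / 2) (half_pos hε)] with n hn
      exact lt_of_le_of_lt (hn _ measurableSet_Iic) (half_lt_self hε)
    refine tendsto_nhds_unique h1 ((Real.tendsto_one_add_div_pow_exp (-N x)).congr' ?_)
    obtain ⟨K, hK⟩ : ∃ K : ℝ, ∀ i, -K ≤ x i := by
      obtain ⟨K, hK⟩ := (Set.finite_range fun i => -x i).bddAbove
      exact ⟨K, fun i => by linarith [hK ⟨i, rfl⟩]⟩
    filter_upwards [hC.eventually_real_Iic K, eventually_ge_atTop 1] with n hn hn1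
    rw [normMaxLaw_real_Iic hUmeas hUindep hUlaw hn1, hn x hK hx]
    ring
  refine ⟨⟨G₀, hG₀, hcdf⟩, fun G hG => ?_⟩
  have := hG.1
  have hGG : G₀ = G := by
    refine Measure.ext_of_Iic_nonpos ?_ fun y hy => ?_
    · rw [hcdf 0 le_rfl, hC.2.1.map_zero]
      simp
    · rw [hcdf y hy, hG.2 y hy]
  subst hGG
  have : Nonempty {A : Set (Fin d → ℝ) // MeasurableSet A} := ⟨⟨∅, .empty⟩⟩
  refine Metric.tendsto_nhds.2 fun ε hε => ?_
  filter_upwards [hlim (ε / 2) (half_pos hε)] with n hn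
  rw [Real.dist_eq, sub_zero, abs_of_nonneg (Real.iSup_nonneg fun _ => abs_nonneg _)]
  refine lt_of_le_of_lt (ciSup_le fun A => ?_) (half_lt_self hε)
  have := hn A.1 A.2
  rwa [normMaxLaw, map_measureReal_apply (measurable_normMax hUmeas n) A.2] at this
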